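/- Let $d\ge 0$, let $P$ be a polynomial in $d$ variables with complex coefficients, and let $P(\partial)$ be the corresponding constant coefficient differential operator on $\mathbb R^d$, so that $P(\partial)e^{i\lambda\cdot x}=P(i\lambda)e^{i\lambda\cdot x}$. Put $\mathcal F f(\lambda)=(2\pi)^{-d/2}\int_{\mathbb R^d}f(x)e^{-i\lambda\cdot x}\,dx$. Let $\widetilde T_1$ be the operator on $L^1(\mathbb R^d)$ whose domain consists of all $f\in L^1(\mathbb R^d)$ for which the tempered distribution $P(\partial)f$ belongs to $L^1(\mathbb R^d)$, with $\widetilde T_1f=P(\partial)f$; its powers $\widetilde T_1^n$ are defined on their natural domains. For an operator $T$ on a complex Banach space $X$ with domain $D_T$ and for $x\in X$, the local resolvent set $\rho_T(x)$ consists of all $z_0\in\mathbb C$ for which there are an open neighbourhood $U$ of $z_0$ and an analytic map $\phi:U\to X$, $z\mapsto\phi_z$, with $\phi_z\in D_T$ and $(T-z)\phi_z=x$ for all $z\in U$; the local spectrum is $\sigma_T(x)=\mathbb C\setminus\rho_T(x)$. The operator $T$ has the single-valued extension property (SVEP) if, for every non-empty open $U\subseteq\mathbb C$, the only analytic $\phi:U\to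 X$ with $\phi_z\in D_T$ and $(T-z)\phi_z=0$ for all $z\in U$ is $\phi=0$. Then $\widetilde T_1$ is closed and has SVEP. Moreover, every Schwartz function $f\in\mathcal S(\mathbb R^d)$ lies in the domain of $\widetilde T_1$, with $\widetilde T_1 f$ equal to the classical $P(\partial)f$, and $$\sigma_{\widetilde T_1}(f)=\overline{\{P(i\lambda):\lambda\in\operatorname{supp}\mathcal F f\}}.$$ Furthermore, such an $f$ lies in the domain of $\widetilde T_1^n$ with $\widetilde T_1^nf=P(\partial)^nf$ for all $n\ge 0$, and in $[0,\infty]$ the limit of $\|\widetilde T_1^nf\|_1^{1/n}$ exists and $$\lim_{n\to\infty}\|\widetilde T_1^nf\|_1^{1/n}=\sup\{|P(i\lambda)|:\lambda\in\operatorname{supp}\mathcal F f\}=\sup\{|z|:z\in\sigma_{\widetilde T_1}(f)\},$$ where the supremum of the empty set is $0$. -/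

import Mathlib

open MeasureTheory Filter Topology
open scoped SchwartzMap LineDeriv ENNReal

noncomputable section

/-- Euclidean space `ℝ^d`. -/
abbrev Euc (d : ℕ) : Type := EuclideanSpace ℝ (Fin d)

/-- The Banach space `L¹(ℝ^d)` of (classes of) complex-valued integrable functions. -/
abbrev L1 (d : ℕ) : Type := Lp ℂ 1 (volume : Measure (Euc d))

section Operators

variable {d : ℕ} {V : Type*} [AddCommGroup V] [Module ℂ V]
  [LineDeriv (Euc d) V V] [LineDerivAdd (Euc d) V V] [LineDerivSMul ℂ (Euc d) V V]

/-- The `j`-th partial derivative `∂_j`, as a linear endomorphism of a space `V` of functions or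
distributions on `ℝ^d`. -/
def partialDeriv (j : Fin d) : Module.End ℂ V where
  toFun u := ∂_{(EuclideanSpace.single j (1 : ℝ) : Euc d)} u
  map_add' := LineDeriv.lineDerivOp_add _
  map_smul' := LineDeriv.lineDerivOp_smul _

/-- `∂^α = ∂_1^{α_1} ⋯ ∂_d^{α_d}` for a multi-index `α`. -/
def multiDeriv (α : Fin d →₀ ℕ) : Module.End ℂ V :=
  (List.ofFn fun j : Fin d => (partialDeriv j : Module.End ℂ V) ^ α j).prod

/-- The constant coefficient differential operator `P(∂) = ∑_α c_α ∂^α` attached to the complex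
polynomial `P = ∑_α c_α X^α`. It is used for `V = 𝓢(ℝ^d)` and for `V = 𝓢'(ℝ^d)`. -/
def diffOp (P : MvPolynomial (Fin d) ℂ) : Module.End ℂ V :=
  ∑ α ∈ P.support, P.coeff α • multiDeriv α

end Operators

/-- The value `P(iξ)`, for `ξ ∈ ℝ^d`. -/
def symbol {d : ℕ} (P : MvPolynomial (Fin d) ℂ) (ξ : Euc d) : ℂ :=
  MvPolynomial.eval (fun j => Complex.I * (ξ j : ℂ)) P

/-- The Fourier transform `ξ ↦ (2π)^{-d/2} ∫ f(x) e^{-i ξ·x} dx`. -/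
def fourierTr {d : ℕ} (f : Euc d → ℂ) (ξ : Euc d) : ℂ :=
  (((2 * Real.pi) ^ (-(d : ℝ) / 2) : ℝ) : ℂ) *
    ∫ x : Euc d, f x * Complex.exp (-(Complex.I * ((∑ j, ξ j * x j : ℝ) : ℂ)))

section ClosedExtension

variable {d : ℕ}

/-- The set of all pairs `(f, g)` in `L¹ × L¹` such that `P(∂) f = g` as tempered distributions. -/
def l1Graph (P : MvPolynomial (Fin d) ℂ) : Submodule ℂ (L1 d × L1 d) where
  carrier := {q | diffOp P (Lp.toTemperedDistributionCLM ℂ volume 1 q.1) =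
    Lp.toTemperedDistributionCLM ℂ volume 1 q.2}
  add_mem' := by
    intro a b ha hb
    simp only [Set.mem_ofPred_eq, Prod.fst_add, Prod.snd_add, map_add] at *
    rw [ha, hb]
  zero_mem' := by
    simp only [Set.mem_ofPred_eq, Prod.fst_zero, Prod.snd_zero, map_zero]
  smul_mem' := by
    intro c a ha
    simp only [Set.mem_ofPred_eq, Prod.smul_fst, Prod.smul_snd, map_smul] at *
    rw [ha]

theorem l1Graph_functional (P : MvPolynomial (Fin d) ℂ) :
    ∀ q ∈ l1Graph P, q.1 = 0 → q.2 = 0 := by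
  intro q hq h0
  have hq' : diffOp P (Lp.toTemperedDistributionCLM ℂ volume 1 q.1) =
    Lp.toTemperedDistributionCLM ℂ volume 1 q.2 := hq
  rw [h0, map_zero, map_zero] at hq'
  have hk := Lp.ker_toTemperedDistributionCLM_eq_bot (E := Euc d) (F := ℂ)
    (μ := volume) (p := 1)
  rw [LinearMap.ker_eq_bot'] at hk
  exact hk q.2 hq'.symm

/-- The operator `T̃₁` on `L¹(ℝ^d)`: its domain consists of all `f ∈ L¹` such that the tempered
distribution `P(∂) f` belongs to `L¹`, and `T̃₁ f = P(∂) f`. -/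
def closedExt (P : MvPolynomial (Fin d) ℂ) : L1 d →ₗ.[ℂ] L1 d :=
  (l1Graph P).toLinearPMap

theorem closedExt_graph (P : MvPolynomial (Fin d) ℂ) : (closedExt P).graph = l1Graph P :=
  Submodule.toLinearPMap_graph_eq _ (l1Graph_functional P)

theorem mem_domain_closedExt (P : MvPolynomial (Fin d) ℂ) (f : L1 d) :
    f ∈ (closedExt P).domain ↔ ∃ g : L1 d,
      diffOp P (Lp.toTemperedDistributionCLM ℂ volume 1 f) =
        Lp.toTemperedDistributionCLM ℂ volume 1 g := by
  constructor
  · intro h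
    have h1 := (closedExt P).mem_graph ⟨f, h⟩
    rw [closedExt_graph] at h1
    exact ⟨_, h1⟩
  · rintro ⟨g, hg⟩
    have h1 : (f, g) ∈ (closedExt P).graph := by
      rw [closedExt_graph]
      exact hg
    exact LinearPMap.mem_domain_of_mem_graph h1

theorem closedExt_apply (P : MvPolynomial (Fin d) ℂ) (f : (closedExt P).domain) :
    Lp.toTemperedDistributionCLM ℂ volume 1 (closedExt P f) =
      diffOp P (Lp.toTemperedDistributionCLM ℂ volume 1 (f : L1 d)) := by
  have h1 := (closedExt P).mem_graph f
  rw [closedExt_graph] at h1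
  exact Eq.symm h1

end ClosedExtension

section LocalSpectralTheory

variable {X : Type*} [NormedAddCommGroup X] [NormedSpace ℂ X]

/-- The composition `S ∘ T` of unbounded operators, on its natural domain
`{x ∈ D(T) : T x ∈ D(S)}`. -/
def unbComp (S T : X →ₗ.[ℂ] X) : X →ₗ.[ℂ] X where
  domain :=
    { carrier := {x | ∃ h : x ∈ T.domain, T ⟨x, h⟩ ∈ S.domain}
      add_mem' := by
        rintro a b ⟨ha, ha'⟩ ⟨hb, hb'⟩
        refine ⟨T.domain.add_mem ha hb, ?_⟩
        have h := T.map_add ⟨a, ha⟩ ⟨b, hb⟩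
        rw [AddMemClass.mk_add_mk] at h
        rw [h]
        exact S.domain.add_mem ha' hb'
      zero_mem' := by
        refine ⟨T.domain.zero_mem, ?_⟩
        have h := T.map_zero
        change T ⟨0, _⟩ = 0 at h
        rw [h]
        exact S.domain.zero_mem
      smul_mem' := by
        rintro c a ⟨ha, ha'⟩
        refine ⟨T.domain.smul_mem c ha, ?_⟩
        have h := T.map_smul c ⟨a, ha⟩
        rw [SetLike.mk_smul_mk] at h
        rw [h]
        exact S.domain.smul_mem c ha' }
  toFun :=
    { toFun := fun x => S ⟨T ⟨x, x.2.fst⟩, x.2.snd⟩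
      map_add' := by
        intro x y
        rw [← S.map_add]
        congr 1
        apply Subtype.ext
        exact T.map_add ⟨x, x.2.fst⟩ ⟨y, y.2.fst⟩
      map_smul' := by
        intro c x
        rw [RingHom.id_apply, ← S.map_smul]
        congr 1
        apply Subtype.ext
        exact T.map_smul c ⟨x, x.2.fst⟩ }

/-- The powers `T^n` of an unbounded operator: `T^0` is the identity on all of `X` and
`T^{n+1} = T ∘ T^n` on its natural domain. -/
def unbPow (T : X →ₗ.[ℂ] X) : ℕ → (X →ₗ.[ℂ] X)
  | 0 => ⟨⊤, (⊤ : Submodule ℂ X).subtype⟩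
  | n + 1 => unbComp T (unbPow T n)

/-- The local resolvent set `ρ_T(x)`: all `z₀ ∈ ℂ` having an open neighbourhood `U` on which there
is an analytic `X`-valued `φ` with values in `D(T)` such that `(T - z) φ_z = x` for `z ∈ U`. -/
def localResolventSet (T : X →ₗ.[ℂ] X) (x : X) : Set ℂ :=
  {z₀ | ∃ U : Set ℂ, IsOpen U ∧ z₀ ∈ U ∧ ∃ φ : ℂ → X, AnalyticOnNhd ℂ φ U ∧
    ∀ z ∈ U, ∃ h : φ z ∈ T.domain, T ⟨φ z, h⟩ - z • φ z = x}

/-- The local spectrum `σ_T(x)`. -/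
def localSpectrum (T : X →ₗ.[ℂ] X) (x : X) : Set ℂ :=
  (localResolventSet T x)ᶜ

/-- The single-valued extension property. -/
def HasSVEP (T : X →ₗ.[ℂ] X) : Prop :=
  ∀ U : Set ℂ, IsOpen U → U.Nonempty → ∀ φ : ℂ → X, AnalyticOnNhd ℂ φ U →
    (∀ z ∈ U, ∃ h : φ z ∈ T.domain, T ⟨φ z, h⟩ - z • φ z = 0) → ∀ z ∈ U, φ z = 0

end LocalSpectralTheory

end

/-!
On the Fourier side `T̃₁` is multiplication by `P(iλ)` with maximal domain on the coordinates
`f ↦ 𝓕 f λ`, which are continuous on `L¹`. This gives closedness and the single-valued extension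
property, and a vector with a nonzero coordinate at `λ` has `P(iλ)` in its local spectrum and powers
growing at least like `|P(iλ)|ⁿ`.

Conversely, if `|h| ≤ A` on the support of `𝓕 f`, then every Schwartz seminorm of `hⁿ 𝓕 f` is at
most a polynomial in `n` times `Aⁿ`. With `h = P(i·)` this bounds the growth of `T̃₁ⁿ f`. If `z₀`
has positive distance from the values of `P(i·)` on the support, `h = (P(i·) - z₀)⁻¹`, modified off
the support to a function of temperate growth, makes `∑ (z - z₀)ⁿ 𝓕⁻¹ (hⁿ⁺¹ 𝓕 f)` a local resolvent.
-/

open scoped FourierTransform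

noncomputable section

theorem iSup_enorm_closure {E : Type*} [SeminormedAddCommGroup E] (s : Set E) :
    ⨆ z ∈ closure s, ‖z‖ₑ = ⨆ z ∈ s, ‖z‖ₑ := by
  have hclosed : IsClosed {w : E | ‖w‖ₑ ≤ ⨆ z ∈ s, ‖z‖ₑ} :=
    isClosed_le continuous_enorm continuous_const
  refine le_antisymm (iSup₂_le fun z hz => ?_) (biSup_mono fun z hz => subset_closure hz)
  exact hclosed.closure_subset_iff.2 (fun w hw => le_iSup₂ (f := fun z _ => ‖z‖ₑ) w hw) hz

section RootGrowth

open ENNReal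

variable {a : ℝ≥0∞} {c u : ℕ → ℝ≥0∞}

theorem le_liminf_rpow_one_div_of_pow_le_mul
    (hc : Tendsto (fun n => c n ^ (1 / (n : ℝ))) atTop (𝓝 1)) (h : ∀ n, a ^ n ≤ c n * u n) :
    a ≤ liminf (fun n => u n ^ (1 / (n : ℝ))) atTop := by
  have hdiv : Tendsto (fun n => a / c n ^ (1 / (n : ℝ))) atTop (𝓝 a) := by
    simpa using ENNReal.Tendsto.const_div (a := a) hc (.inl one_ne_top)
  refine hdiv.liminf_eq.symm.trans_le (liminf_le_liminf ?_)
  filter_upwards [eventually_ne_atTop 0] with n hn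
  refine ENNReal.div_le_of_le_mul' ?_
  rw [← ENNReal.mul_rpow_of_nonneg _ _ (by positivity), ← ENNReal.pow_rpow_inv_natCast hn a,
    one_div]
  gcongr
  exact h n

theorem limsup_rpow_one_div_le_of_le_mul_pow
    (hc : Tendsto (fun n => c n ^ (1 / (n : ℝ))) atTop (𝓝 1)) (h : ∀ n, u n ≤ c n * a ^ n) :
    limsup (fun n => u n ^ (1 / (n : ℝ))) atTop ≤ a := by
  have hmul : Tendsto (fun n => c n ^ (1 / (n : ℝ)) * a) atTop (𝓝 a) := by
    simpa using ENNReal.Tendsto.mul_const (b := a) hc (.inl one_ne_zero)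
  refine (limsup_le_limsup ?_).trans_eq hmul.limsup_eq
  filter_upwards [eventually_ne_atTop 0] with n hn
  nth_rw 1 [← ENNReal.pow_rpow_inv_natCast hn a]
  rw [← one_div, ← ENNReal.mul_rpow_of_nonneg _ _ (by positivity)]
  gcongr
  exact h n

theorem tendsto_const_mul_succ_pow_rpow_one_div {C : ℝ≥0∞} (h0 : C ≠ 0) (hC : C ≠ ∞) (m : ℕ) :
    Tendsto (fun n : ℕ => (C * (n + 1) ^ m) ^ (1 / (n : ℝ))) atTop (𝓝 1) := by
  lift C to NNReal using hC
  have hCpos : 0 < (C : ℝ) := NNReal.coe_pos.2 (pos_iff_ne_zero.2 (by exact_mod_cast h0))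
  have hconst : Tendsto (fun n : ℕ => (C : ℝ) ^ (1 / (n : ℝ))) atTop (𝓝 1) := by
    simpa [Function.comp_def] using
      (Real.continuousAt_const_rpow (b := 0) hCpos.ne').tendsto.comp
        tendsto_one_div_atTop_nhds_zero_nat
  have hsucc : Tendsto (fun n : ℕ => ((n : ℝ) + 1) ^ (1 / (n : ℝ))) atTop (𝓝 1) := by
    simpa [Function.comp_def] using (tendsto_rpow_div_mul_add 1 1 (-1) (by norm_num)).comp
      (tendsto_atTop_add_const_right atTop (1 : ℝ) tendsto_natCast_atTop_atTop)
  have hreal := ENNReal.tendsto_ofReal (hconst.mul (hsucc.pow m))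
  simp only [one_pow, mul_one, ENNReal.ofReal_one] at hreal
  refine hreal.congr fun n => ?_
  rw [Real.rpow_pow_comm (by positivity), ← Real.mul_rpow (by positivity) (by positivity),
    ← ENNReal.ofReal_rpow_of_nonneg (by positivity) (by positivity),
    ENNReal.ofReal_mul (by positivity), ENNReal.ofReal_pow (by positivity),
    ENNReal.ofReal_add (by positivity) zero_le_one]
  simp

end RootGrowth

section UnboundedOperators

variable {X : Type*} [NormedAddCommGroup X] [NormedSpace ℂ X] {T : X →ₗ.[ℂ] X}

theorem exists_apply_eq_iff_mem_graph {x y : X} :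
    (∃ h : x ∈ T.domain, T ⟨x, h⟩ = y) ↔ (x, y) ∈ T.graph := by
  simp [LinearPMap.mem_graph_iff]

theorem exists_apply_sub_smul_eq_iff_mem_graph {x y : X} {z : ℂ} :
    (∃ h : x ∈ T.domain, T ⟨x, h⟩ - z • x = y) ↔ (x, y + z • x) ∈ T.graph := by
  simp only [sub_eq_iff_eq_add, exists_apply_eq_iff_mem_graph]

theorem isOpen_localResolventSet (T : X →ₗ.[ℂ] X) (x : X) : IsOpen (localResolventSet T x) :=
  isOpen_iff_mem_nhds.2 fun _ ⟨U, hU, hz, φ, hφ, h⟩ =>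
    Filter.mem_of_superset (hU.mem_nhds hz) fun _ hw => ⟨U, hU, hw, φ, hφ, h⟩

theorem isClosed_localSpectrum (T : X →ₗ.[ℂ] X) (x : X) : IsClosed (localSpectrum T x) :=
  (isOpen_localResolventSet T x).isClosed_compl

theorem mem_localResolventSet_of_backwardOrbit [CompleteSpace X] (hT : T.IsClosed) {b : ℕ → X}
    {z₀ : ℂ} {r : ℝ} (hr : 0 < r)
    (hb : ∀ n, (b (n + 1), b n + z₀ • b (n + 1)) ∈ T.graph)
    (hsum : Summable fun n => ‖b (n + 1)‖ * r ^ n) : z₀ ∈ localResolventSet T (b 0) := by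
  have norm_le (n : ℕ) {z : ℂ} (hz : z ∈ Metric.ball z₀ r) :
      ‖(z - z₀) ^ n • b (n + 1)‖ ≤ ‖b (n + 1)‖ * r ^ n := by
    rw [norm_smul, norm_pow, mul_comm]
    gcongr
    exact (mem_ball_iff_norm.1 hz).le
  refine ⟨Metric.ball z₀ r, Metric.isOpen_ball, Metric.mem_ball_self hr,
    fun z => ∑' n, (z - z₀) ^ n • b (n + 1), ?_, fun z hz => ?_⟩
  · refine DifferentiableOn.analyticOnNhd ?_ Metric.isOpen_ball
    exact Complex.differentiableOn_tsum_of_summable_norm hsum (fun n => by fun_prop)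
      Metric.isOpen_ball fun n _ hz => norm_le n hz
  -- `T - z₀` shifts the series by one index, so `(T - z) φ_z` telescopes to `b 0`.
  have hφ : HasSum (fun n => (z - z₀) ^ n • b (n + 1)) (∑' n, (z - z₀) ^ n • b (n + 1)) :=
    (Summable.of_norm_bounded hsum fun n => norm_le n hz).hasSum
  have hshift : HasSum (fun n => (z - z₀) ^ n • b n)
      (b 0 + (z - z₀) • ∑' n, (z - z₀) ^ n • b (n + 1)) := by
    rw [add_comm, ← hasSum_nat_add_iff' 1]
    simpa [pow_succ', mul_smul] using hφ.const_smul (z - z₀)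
  rw [exists_apply_sub_smul_eq_iff_mem_graph]
  have hlim := hφ.prodMk (hshift.add (hφ.const_smul z₀))
  rw [add_assoc, ← add_smul, sub_add_cancel] at hlim
  refine IsClosed.mem_of_tendsto hT hlim (.of_forall fun s => T.graph.sum_mem fun n _ => ?_)
  simpa [smul_comm z₀] using T.graph.smul_mem ((z - z₀) ^ n) (hb n)

theorem exists_unbPow_eq_map_pow {W : Type*} [AddCommGroup W] [Module ℂ W] {D : Module.End ℂ W}
    {L : W → X} (hL : ∀ v, (L v, L (D v)) ∈ T.graph) (v : W) (n : ℕ) :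
    ∃ h : L v ∈ (unbPow T n).domain, unbPow T n ⟨L v, h⟩ = L ((D ^ n) v) := by
  induction n with
  | zero => exact ⟨Submodule.mem_top, rfl⟩
  | succ n ih =>
    obtain ⟨hv, hn⟩ := ih
    obtain ⟨hDv, hn'⟩ := exists_apply_eq_iff_mem_graph.2 (hL ((D ^ n) v))
    simp only [← hn] at hDv hn'
    exact ⟨⟨hv, hDv⟩, by rw [pow_succ', Module.End.mul_apply, ← hn']; rfl⟩

end UnboundedOperators

section Diagonalization

variable {X F ι : Type*} [NormedAddCommGroup X] [NormedSpace ℂ X] [NormedAddCommGroup F]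
  [NormedSpace ℂ F] {T : X →ₗ.[ℂ] X} {ℓ : ι → X →L[ℂ] F} {m : ι → ℂ} {x : X}

/-- The unbounded operator `T` acts as multiplication by `m` on the coordinates `ℓ i x`, with
maximal domain. For a differential operator on `L¹` the coordinates are the values of the Fourier
transform. The condition involves the graph only, and it forces the coordinates to separate
points, because the graph of `T` is functional. -/
def IsDiagonalizedBy (T : X →ₗ.[ℂ] X) (ℓ : ι → X →L[ℂ] F) (m : ι → ℂ) : Prop :=
  ∀ x y, (x, y) ∈ T.graph ↔ ∀ i, ℓ i y = m i • ℓ i x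

namespace IsDiagonalizedBy

theorem isClosed (hT : IsDiagonalizedBy T ℓ m) : T.IsClosed := by
  have hgraph : (T.graph : Set (X × X)) = ⋂ i, {q | ℓ i q.2 = m i • ℓ i q.1} := by
    ext ⟨x, y⟩
    simpa using! hT x y
  rw [LinearPMap.IsClosed, hgraph]
  exact isClosed_iInter fun i => isClosed_eq (by fun_prop) (by fun_prop)

theorem eq_zero (hT : IsDiagonalizedBy T ℓ m) (hx : ∀ i, ℓ i x = 0) : x = 0 :=
  LinearPMap.graph_fst_eq_zero_snd T ((hT 0 x).2 (by simpa using hx)) rfl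

theorem sub_smul_eq_of_exists (hT : IsDiagonalizedBy T ℓ m) {y : X} {z : ℂ}
    (h : ∃ h : x ∈ T.domain, T ⟨x, h⟩ - z • x = y) (i : ι) : ℓ i y = (m i - z) • ℓ i x := by
  have hi := (hT _ _).1 (exists_apply_sub_smul_eq_iff_mem_graph.1 h) i
  rw [map_add, map_smul] at hi
  rw [sub_smul, ← hi, add_sub_cancel_right]

theorem hasSVEP (hT : IsDiagonalizedBy T ℓ m) : HasSVEP T := by
  intro U hU _ φ hφ h z hz
  refine hT.eq_zero fun i => ?_
  have hne : (fun w => ℓ i (φ w)) =ᶠ[𝓝[≠] z] fun _ => 0 := by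
    have : ∀ᶠ w in 𝓝[≠] z, w ≠ m i := by
      by_cases hzi : z = m i
      · exact hzi ▸ self_mem_nhdsWithin
      · exact (continuousAt_id.eventually_ne hzi).filter_mono nhdsWithin_le_nhds
    filter_upwards [this, mem_nhdsWithin_of_mem_nhds (hU.mem_nhds hz)] with w hw hwU
    have hi := hT.sub_smul_eq_of_exists (h w hwU) i
    rw [map_zero, eq_comm, smul_eq_zero] at hi
    exact hi.resolve_left (sub_ne_zero.2 hw.symm)
  have hcont : ContinuousAt (fun w => ℓ i (φ w)) z :=
    (ℓ i).continuous.continuousAt.comp (hφ z hz).continuousAt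
  exact ((hcont.eventuallyEq_nhds_iff_eventuallyEq_nhdsNE continuousAt_const).1 hne).eq_of_nhds

theorem closure_image_subset_localSpectrum (hT : IsDiagonalizedBy T ℓ m) (x : X) :
    closure (m '' {i | ℓ i x ≠ 0}) ⊆ localSpectrum T x := by
  refine closure_minimal ?_ (isClosed_localSpectrum T x)
  rintro _ ⟨i, hi, rfl⟩ ⟨U, -, hU, φ, -, h⟩
  exact hi (by simpa using hT.sub_smul_eq_of_exists (h _ hU) i)

theorem map_unbPow (hT : IsDiagonalizedBy T ℓ m) (i : ι) (n : ℕ) (h : x ∈ (unbPow T n).domain) :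
    ℓ i (unbPow T n ⟨x, h⟩) = m i ^ n • ℓ i x := by
  induction n with
  | zero => rw [pow_zero, one_smul]; rfl
  | succ n ih =>
    rw [pow_succ', mul_smul, ← ih h.fst]
    exact (hT _ _).1 (exists_apply_eq_iff_mem_graph.1 ⟨h.snd, rfl⟩) i

theorem iSup_enorm_le_liminf (hT : IsDiagonalizedBy T ℓ m)
    (h : ∀ n, x ∈ (unbPow T n).domain) :
    ⨆ i ∈ {i | ℓ i x ≠ 0}, ‖m i‖ₑ ≤
      liminf (fun n => ‖unbPow T n ⟨x, h n⟩‖ₑ ^ (1 / (n : ℝ))) atTop := by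
  refine iSup₂_le fun i hi => ?_
  have hx : ‖ℓ i x‖ₑ ≠ 0 := enorm_ne_zero.2 hi
  have hℓ : ‖ℓ i‖ₑ ≠ 0 := fun h0 => hx (by simpa [h0] using (ℓ i).le_opENorm x)
  have hroot := tendsto_const_mul_succ_pow_rpow_one_div (C := ‖ℓ i‖ₑ / ‖ℓ i x‖ₑ)
    (ENNReal.div_ne_zero.2 ⟨hℓ, enorm_ne_top⟩) (ENNReal.div_ne_top enorm_ne_top hx) 0
  refine le_liminf_rpow_one_div_of_pow_le_mul hroot fun n => ?_
  have hbound : ‖m i‖ₑ ^ n * ‖ℓ i x‖ₑ ≤ ‖ℓ i‖ₑ * ‖unbPow T n ⟨x, h n⟩‖ₑ := by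
    rw [← enorm_pow, ← enorm_smul, ← hT.map_unbPow i n (h n)]
    exact (ℓ i).le_opENorm _
  rw [pow_zero, mul_one, ← ENNReal.mul_div_right_comm]
  exact (ENNReal.le_div_iff_mul_le (.inl hx) (.inl enorm_ne_top)).2 hbound

end IsDiagonalizedBy

end Diagonalization

section MultiplierPowers

variable {E : Type*} [NormedAddCommGroup E] [NormedSpace ℝ E] {h : E → ℂ} {x : E} {A B : ℝ}
  {l : ℕ}

theorem norm_iteratedFDeriv_pow_le (hh : ContDiff ℝ l h)
    (hAB : ∀ i ≤ l, ‖iteratedFDeriv ℝ i h x‖ ≤ A * B ^ i) (n : ℕ) :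
    ∀ j ≤ l, ‖iteratedFDeriv ℝ j (h ^ n) x‖ ≤ A ^ n * (n * B) ^ j := by
  induction n with
  | zero =>
    intro j _
    obtain rfl | hj := eq_or_ne j 0
    · simp
    · simp [iteratedFDeriv_const_of_ne hj, Pi.one_def, hj]
  | succ n ih =>
    intro j hj
    rw [pow_succ']
    calc ‖iteratedFDeriv ℝ j (fun y => h y * (h ^ n) y) x‖
        ≤ ∑ i ∈ Finset.range (j + 1), (j.choose i : ℝ) * ‖iteratedFDeriv ℝ i h x‖ *
            ‖iteratedFDeriv ℝ (j - i) (h ^ n) x‖ :=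
          norm_iteratedFDeriv_mul_le hh (hh.pow n) x (by exact_mod_cast hj)
      _ ≤ ∑ i ∈ Finset.range (j + 1), (j.choose i : ℝ) * (A * B ^ i) *
            (A ^ n * (n * B) ^ (j - i)) := by
          refine Finset.sum_le_sum fun i hi => ?_
          have hij : i ≤ j := Finset.mem_range_succ_iff.1 hi
          have hi0 := (norm_nonneg _).trans (hAB i (hij.trans hj))
          gcongr
          exacts [hAB i (hij.trans hj), ih _ (by lia)]
      _ = A ^ (n + 1) * (B + n * B) ^ j := by
          rw [add_pow, Finset.mul_sum]
          exact Finset.sum_congr rfl fun i _ => by ring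
      _ = A ^ (n + 1) * ((n + 1 : ℕ) * B) ^ j := by push_cast; ring

variable {F : Type*} [NormedAddCommGroup F] [NormedSpace ℂ F]

theorem norm_iteratedFDeriv_pow_smul_le {g : E → F} (hh : ContDiff ℝ l h) (hg : ContDiff ℝ l g)
    (hB : 1 ≤ B) (hAB : ∀ i ≤ l, ‖iteratedFDeriv ℝ i h x‖ ≤ A * B ^ i) (n : ℕ) :
    ‖iteratedFDeriv ℝ l (fun y => h y ^ n • g y) x‖ ≤ A ^ n * ((n + 1) * B) ^ l *
      ∑ i ∈ Finset.range (l + 1), (l.choose i : ℝ) * ‖iteratedFDeriv ℝ (l - i) g x‖ := by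
  have hA : 0 ≤ A := (norm_nonneg _).trans (by simpa using hAB 0 l.zero_le)
  rw [Finset.mul_sum]
  refine (norm_iteratedFDeriv_smul_le (hh.pow n) hg x le_rfl).trans
    (Finset.sum_le_sum fun i hi => ?_)
  have hil : i ≤ l := Finset.mem_range_succ_iff.1 hi
  have hpow : ‖iteratedFDeriv ℝ i (fun y => h y ^ n) x‖ ≤ A ^ n * ((n + 1) * B) ^ l :=
    calc ‖iteratedFDeriv ℝ i (h ^ n) x‖ ≤ A ^ n * (n * B) ^ i :=
          norm_iteratedFDeriv_pow_le hh hAB n i hil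
      _ ≤ A ^ n * ((n + 1) * B) ^ i := by gcongr; linarith
      _ ≤ A ^ n * ((n + 1) * B) ^ l := by
          gcongr
          nlinarith [n.cast_nonneg (α := ℝ)]
  rw [mul_left_comm, mul_assoc]
  gcongr

theorem exists_norm_iteratedFDeriv_le_mul_pow (hh : h.HasTemperateGrowth) (hA : 0 < A) (l : ℕ) :
    ∃ (k : ℕ) (B : ℝ), 1 ≤ B ∧ ∀ x, ‖h x‖ ≤ A → ∀ i ≤ l,
      ‖iteratedFDeriv ℝ i h x‖ ≤ A * (B * (1 + ‖x‖) ^ k) ^ i := by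
  obtain ⟨k, C, hC, hbound⟩ := hh.norm_iteratedFDeriv_le_uniform l
  refine ⟨k, C / A + 1, le_add_of_nonneg_left (by positivity), fun x hx i hi => ?_⟩
  obtain rfl | hi0 := eq_or_ne i 0
  · simpa using hx
  have hone : 1 ≤ (1 + ‖x‖) ^ k := one_le_pow₀ (le_add_of_nonneg_right (norm_nonneg x))
  have hCA : 0 ≤ C / A := by positivity
  calc ‖iteratedFDeriv ℝ i h x‖ ≤ C * (1 + ‖x‖) ^ k := hbound i hi x
    _ ≤ A * ((C / A + 1) * (1 + ‖x‖) ^ k) := by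
        rw [← mul_assoc, mul_add, mul_div_cancel₀ _ hA.ne']
        gcongr
        linarith
    _ ≤ A * ((C / A + 1) * (1 + ‖x‖) ^ k) ^ i := by
        gcongr
        exact le_self_pow₀ (by nlinarith) hi0

theorem exists_seminorm_smulLeftCLM_pow_le (hh : h.HasTemperateGrowth) (hA : 0 < A) (g : 𝓢(E, F))
    (hg : ∀ x ∈ tsupport g, ‖h x‖ ≤ A) (k l : ℕ) :
    ∃ C : ℝ, ∀ n : ℕ, SchwartzMap.seminorm ℂ k l (SchwartzMap.smulLeftCLM F (h ^ n) g) ≤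
      C * (n + 1) ^ l * A ^ n := by
  obtain ⟨p, B, hB, hbound⟩ := exists_norm_iteratedFDeriv_le_mul_pow hh hA l
  let S := 2 ^ (k + p * l) * (Finset.Iic (k + p * l, l)).sup
    (fun m => SchwartzMap.seminorm ℂ m.1 m.2) g
  refine ⟨B ^ l * ∑ i ∈ Finset.range (l + 1), (l.choose i : ℝ) * S, fun n => ?_⟩
  refine SchwartzMap.seminorm_le_bound ℂ _ _ _ (by positivity) fun x => ?_
  have hcoe : ⇑(SchwartzMap.smulLeftCLM F (h ^ n) g) = fun y => h y ^ n • g y := by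
    ext y
    rw [SchwartzMap.smulLeftCLM_apply_apply (hh.pow n), Pi.pow_apply]
  rw [hcoe]
  by_cases hx : x ∈ tsupport g
  · have hone : 1 ≤ 1 + ‖x‖ := le_add_of_nonneg_right (norm_nonneg x)
    calc ‖x‖ ^ k * ‖iteratedFDeriv ℝ l (fun y => h y ^ n • g y) x‖
        ≤ (1 + ‖x‖) ^ k * (A ^ n * ((n + 1) * (B * (1 + ‖x‖) ^ p)) ^ l *
            ∑ i ∈ Finset.range (l + 1), (l.choose i : ℝ) * ‖iteratedFDeriv ℝ (l - i) g x‖) := by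
          gcongr
          · linarith
          · exact norm_iteratedFDeriv_pow_smul_le (hh.1.of_le (mod_cast le_top)) (g.smooth l)
              (one_le_mul_of_one_le_of_one_le hB (one_le_pow₀ hone)) (hbound x (hg x hx)) n
      _ = A ^ n * (n + 1) ^ l * B ^ l * ∑ i ∈ Finset.range (l + 1), (l.choose i : ℝ) *
            ((1 + ‖x‖) ^ (k + p * l) * ‖iteratedFDeriv ℝ (l - i) g x‖) := by
          simp only [Finset.mul_sum, mul_pow, ← pow_mul, pow_add]
          exact Finset.sum_congr rfl fun i _ => by ring
      _ ≤ A ^ n * (n + 1) ^ l * B ^ l * ∑ i ∈ Finset.range (l + 1), (l.choose i : ℝ) * S := by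
          gcongr
          exact SchwartzMap.one_add_le_sup_seminorm_apply (𝕜 := ℂ)
            (m := (k + p * l, l)) le_rfl (Nat.sub_le _ _) g x
      _ = _ := by ring
  · have hsub := (support_iteratedFDeriv_subset (𝕜 := ℝ) (f := fun y => h y ^ n • g y) l).trans
      (tsupport_smul_subset_right (fun y => h y ^ n) g)
    rw [Function.notMem_support.1 fun hx' => hx (hsub hx'), norm_zero, mul_zero]
    positivity

variable {X : Type*} [SeminormedAddCommGroup X] [NormedSpace ℂ X]

theorem exists_norm_map_smulLeftCLM_pow_le (L : 𝓢(E, F) →L[ℂ] X) (hh : h.HasTemperateGrowth)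
    (hA : 0 < A) (g : 𝓢(E, F)) (hg : ∀ x ∈ tsupport g, ‖h x‖ ≤ A) :
    ∃ (C : ℝ) (m : ℕ), 0 < C ∧ ∀ n : ℕ,
      ‖L (SchwartzMap.smulLeftCLM F (h ^ n) g)‖ ≤ C * (n + 1) ^ m * A ^ n := by
  obtain ⟨s, K, -, hK⟩ := Seminorm.bound_of_continuous (schwartz_withSeminorms ℂ E F)
    ((normSeminorm ℂ X).comp L.toLinearMap) (continuous_norm.comp L.continuous)
  choose c hc using fun i : ℕ × ℕ => exists_seminorm_smulLeftCLM_pow_le hh hA g hg i.1 i.2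
  refine ⟨K * ∑ i ∈ s, |c i| + 1, s.sup Prod.snd, by positivity, fun n => ?_⟩
  calc ‖L (SchwartzMap.smulLeftCLM F (h ^ n) g)‖
      ≤ K * (s.sup (schwartzSeminormFamily ℂ E F)) (SchwartzMap.smulLeftCLM F (h ^ n) g) := hK _
    _ ≤ K * ∑ i ∈ s, schwartzSeminormFamily ℂ E F i (SchwartzMap.smulLeftCLM F (h ^ n) g) := by
        gcongr
        simpa using! Seminorm.finset_sup_le_sum (schwartzSeminormFamily ℂ E F) s
          (SchwartzMap.smulLeftCLM F (h ^ n) g)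
    _ ≤ K * ∑ i ∈ s, |c i| * (n + 1) ^ s.sup Prod.snd * A ^ n := by
        gcongr with i hi
        refine (hc i n).trans ?_
        have hone : 1 ≤ (n + 1 : ℝ) := le_add_of_nonneg_left n.cast_nonneg
        gcongr
        exacts [le_abs_self _, Finset.le_sup (f := Prod.snd) hi]
    _ ≤ (K * ∑ i ∈ s, |c i| + 1) * (n + 1) ^ s.sup Prod.snd * A ^ n := by
        rw [← Finset.sum_mul, ← Finset.sum_mul, ← mul_assoc, ← mul_assoc]
        gcongr
        linarith

end MultiplierPowers

section TemperateInverse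

theorem norm_iteratedFDerivWithin_inv_Ici_le {c : ℝ} (hc : 0 < c) (n : ℕ) {x : ℝ}
    (hx : x ∈ Set.Ici c) :
    ‖iteratedFDerivWithin ℝ n (fun y : ℝ => y⁻¹) (Set.Ici c) x‖ ≤
      n.factorial * (c ^ (n + 1))⁻¹ := by
  have hx0 : 0 < x := hc.trans_le hx
  rw [norm_iteratedFDerivWithin_eq_norm_iteratedDerivWithin,
    iteratedDerivWithin_eq_iteratedDeriv (uniqueDiffOn_Ici c) (contDiffAt_inv ℝ hx0.ne') hx,
    iteratedDeriv_eq_iterate, iter_deriv_inv]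
  have hpow : x ^ (-1 - n : ℤ) = (x ^ (n + 1))⁻¹ := by
    rw [← zpow_natCast, ← zpow_neg]
    congr 1
    push_cast
    ring
  rw [hpow, norm_mul, norm_mul, norm_pow, norm_neg, norm_one, one_pow, one_mul, norm_inv, norm_pow,
    Real.norm_of_nonneg hx0.le, Real.norm_natCast]
  gcongr
  exact hx

theorem hasTemperateGrowth_inv {E : Type*} [NormedAddCommGroup E] [NormedSpace ℝ E] {f : E → ℝ}
    (hf : f.HasTemperateGrowth) {c : ℝ} (hc : 0 < c) (hcf : ∀ x, c ≤ f x) :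
    (fun x => (f x)⁻¹).HasTemperateGrowth := by
  refine Function.HasTemperateGrowth.comp' (g := fun y : ℝ => y⁻¹) (t := Set.Ici c)
    (Set.range_subset_iff.2 hcf) (uniqueDiffOn_Ici c)
    (contDiffOn_id.inv fun y hy => (hc.trans_le hy).ne') (fun N => ?_) hf
  refine ⟨0, ∑ n ∈ Finset.range (N + 1), n.factorial * (c ^ (n + 1))⁻¹, by positivity,
    fun n hn y hy => ?_⟩
  rw [pow_zero, mul_one]
  exact (norm_iteratedFDerivWithin_inv_Ici_le hc n hy).trans <|
    Finset.single_le_sum (f := fun n : ℕ => (n.factorial : ℝ) * (c ^ (n + 1))⁻¹)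
      (fun _ _ => by positivity) (Finset.mem_range_succ_iff.2 hn)

theorem exists_hasTemperateGrowth_eq_inv {δ : ℝ} (hδ : 0 < δ) :
    ∃ ψ : ℂ → ℂ, ψ.HasTemperateGrowth ∧ ∀ w, δ ≤ ‖w‖ → ψ w = w⁻¹ := by
  -- The bump `b` keeps the denominator of `w⁻¹ = conj w / ‖w‖ ^ 2` away from `0` near the origin.
  let b : ContDiffBump (0 : ℂ) := ⟨δ / 2, δ, by positivity, by linarith⟩
  have hb : (fun w => ‖w‖ ^ 2 + b w).HasTemperateGrowth :=
    .add (Function.hasTemperateGrowth_norm_sq ℂ) (b.hasCompactSupport.hasTemperateGrowth b.contDiff)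
  have hlower (w : ℂ) : min ((δ / 2) ^ 2) 1 ≤ ‖w‖ ^ 2 + b w := by
    obtain hw | hw := le_total ‖w‖ (δ / 2)
    · rw [b.one_of_mem_closedBall (mem_closedBall_zero_iff.2 hw)]
      exact (min_le_right _ _).trans (le_add_of_nonneg_left (by positivity))
    · refine (min_le_left _ _).trans (le_add_of_le_of_nonneg ?_ b.nonneg)
      gcongr
  refine ⟨fun w => starRingEnd ℂ w * ((‖w‖ ^ 2 + b w)⁻¹ : ℝ), ?_, fun w hw => ?_⟩
  · exact Complex.conjCLE.toContinuousLinearMap.hasTemperateGrowth.mul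
      (Function.Complex.hasTemperateGrowth_ofReal.comp
        (hasTemperateGrowth_inv hb (by positivity) hlower))
  · beta_reduce
    rw [b.zero_of_le_dist (by simpa using hw), add_zero, Complex.inv_def,
      Complex.normSq_eq_norm_sq]

end TemperateInverse

section FourierMultipliers

section Algebra

variable (V : Type*) [NormedAddCommGroup V] [NormedSpace ℝ V]

/-- The algebra of smooth functions of temperate growth, on which `g ↦ (Fourier multiplier of g)` is
an algebra homomorphism. -/
def temperateGrowthSubalgebra : Subalgebra ℂ (V → ℂ) where
  carrier := {g | g.HasTemperateGrowth}
  mul_mem' := Function.HasTemperateGrowth.mul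
  add_mem' := Function.HasTemperateGrowth.add
  algebraMap_mem' := Function.HasTemperateGrowth.const

end Algebra

variable (V F : Type*) [NormedAddCommGroup V] [InnerProductSpace ℝ V] [FiniteDimensional ℝ V]
  [MeasurableSpace V] [BorelSpace V] [NormedAddCommGroup F] [NormedSpace ℂ F]

/-- The action of Fourier multipliers of temperate growth on Schwartz functions. -/
def schwartzMultiplierHom [CompleteSpace F] :
    temperateGrowthSubalgebra V →ₐ[ℂ] Module.End ℂ 𝓢(V, F) :=
  AlgHom.ofLinearMap
    { toFun g := (SchwartzMap.fourierMultiplierCLM F (g : V → ℂ)).toLinearMap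
      map_add' g₁ g₂ := by
        ext1 f
        simp [SchwartzMap.fourierMultiplierCLM_apply, SchwartzMap.smulLeftCLM_add g₁.2 g₂.2]
      map_smul' c g := by
        ext1 f
        simp [SchwartzMap.fourierMultiplierCLM_smul g.2] }
    (by
      ext1 f
      exact DFunLike.congr_fun ((SchwartzMap.fourierMultiplierCLM_const 1).trans (one_smul ℂ _)) f)
    (fun g₁ g₂ => by
      ext1 f
      exact (SchwartzMap.fourierMultiplierCLM_fourierMultiplierCLM_apply g₁.2 g₂.2 f).symm)

/-- The action of Fourier multipliers of temperate growth on tempered distributions. -/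
def temperedMultiplierHom : temperateGrowthSubalgebra V →ₐ[ℂ] Module.End ℂ 𝓢'(V, F) :=
  AlgHom.ofLinearMap
    { toFun g := (TemperedDistribution.fourierMultiplierCLM F (g : V → ℂ)).toLinearMap
      map_add' g₁ g₂ := by
        ext f u
        simp [SchwartzMap.smulLeftCLM_add g₁.2 g₂.2]
      map_smul' c g := by
        ext1 f
        simp [TemperedDistribution.fourierMultiplierCLM_smul g.2] }
    (by
      ext1 f
      exact DFunLike.congr_fun
        ((TemperedDistribution.fourierMultiplierCLM_const 1).trans (one_smul ℂ _)) f)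
    (fun g₁ g₂ => by
      ext1 f
      rw [mul_comm]
      exact (TemperedDistribution.fourierMultiplierCLM_fourierMultiplierCLM_apply g₂.2 g₁.2 f).symm)

variable {V}

/-- The multiplier `ξ ↦ 2πi⟪ξ, v⟫` of the directional derivative `∂_v`. -/
def derivMultiplier (v : V) : temperateGrowthSubalgebra V :=
  ⟨(2 * Real.pi * Complex.I) • fun ξ => ((inner ℝ ξ v : ℝ) : ℂ), by
    change Function.HasTemperateGrowth _
    fun_prop⟩

theorem schwartzMultiplierHom_derivMultiplier [CompleteSpace F] (v : V) (f : 𝓢(V, F)) :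
    schwartzMultiplierHom V F (derivMultiplier v) f = ∂_{v} f := by
  have hv : (fun ξ : V => inner ℝ ξ v).HasTemperateGrowth := by fun_prop
  rw [SchwartzMap.lineDeriv_eq_fourierMultiplierCLM, ← SchwartzMap.fourierMultiplierCLM_ofReal ℂ hv]
  exact DFunLike.congr_fun (SchwartzMap.fourierMultiplierCLM_smul (by fun_prop) _) f

theorem temperedMultiplierHom_derivMultiplier (v : V) (u : 𝓢'(V, F)) :
    temperedMultiplierHom V F (derivMultiplier v) u = ∂_{v} u := by
  rw [TemperedDistribution.lineDeriv_eq_fourierMultiplierCLM]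
  exact DFunLike.congr_fun (TemperedDistribution.fourierMultiplierCLM_smul (by fun_prop) _) u

end FourierMultipliers

section DifferentialOperators

variable {d : ℕ}

theorem diffOp_eq_map_aeval {V A : Type*} [AddCommGroup V] [Module ℂ V]
    [LineDeriv (Euc d) V V] [LineDerivAdd (Euc d) V V] [LineDerivSMul ℂ (Euc d) V V]
    [CommSemiring A] [Algebra ℂ A] (Φ : A →ₐ[ℂ] Module.End ℂ V) {a : Fin d → A}
    (h : ∀ j, Φ (a j) = partialDeriv j) (P : MvPolynomial (Fin d) ℂ) :
    diffOp P = Φ (MvPolynomial.aeval a P) := by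
  rw [MvPolynomial.aeval_def, MvPolynomial.eval₂_eq', map_sum, diffOp]
  refine Finset.sum_congr rfl fun α _ => ?_
  rw [← Algebra.smul_def, map_smul, multiDeriv, ← List.prod_ofFn, map_list_prod, List.map_ofFn]
  simp only [Function.comp_def, map_pow, h]

/-- The symbol of `P(∂)` in the normalization `𝓕 f ξ = ∫ f(x) e^{-2πi⟪x, ξ⟫} dx` of the Fourier
transform, which replaces `λ` by `2πξ`. -/
def multiplier (P : MvPolynomial (Fin d) ℂ) (ξ : Euc d) : ℂ :=
  symbol P ((2 * Real.pi) • ξ)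

theorem coe_aeval_derivMultiplier (P : MvPolynomial (Fin d) ℂ) :
    (MvPolynomial.aeval (fun j => derivMultiplier (EuclideanSpace.single j (1 : ℝ) : Euc d)) P :
      Euc d → ℂ) = multiplier P := by
  ext ξ
  change ((Pi.evalAlgHom ℂ (fun _ : Euc d => ℂ) ξ).comp (temperateGrowthSubalgebra (Euc d)).val)
    (MvPolynomial.aeval _ P) = _
  rw [MvPolynomial.comp_aeval_apply, multiplier, symbol, ← MvPolynomial.aeval_eq_eval]
  congr 2
  ext j
  simp [derivMultiplier, EuclideanSpace.inner_single_right]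
  ring

theorem hasTemperateGrowth_multiplier (P : MvPolynomial (Fin d) ℂ) :
    (multiplier P).HasTemperateGrowth := by
  rw [← coe_aeval_derivMultiplier]
  exact Subtype.property _

theorem diffOp_eq_fourierMultiplierCLM (P : MvPolynomial (Fin d) ℂ) (f : 𝓢(Euc d, ℂ)) :
    diffOp P f = SchwartzMap.fourierMultiplierCLM ℂ (multiplier P) f := by
  rw [diffOp_eq_map_aeval (schwartzMultiplierHom (Euc d) ℂ) (fun j => LinearMap.ext fun f =>
    schwartzMultiplierHom_derivMultiplier ℂ _ f), ← coe_aeval_derivMultiplier]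
  rfl

theorem diffOp_eq_temperedFourierMultiplierCLM (P : MvPolynomial (Fin d) ℂ) (u : 𝓢'(Euc d, ℂ)) :
    diffOp P u = TemperedDistribution.fourierMultiplierCLM ℂ (multiplier P) u := by
  rw [diffOp_eq_map_aeval (temperedMultiplierHom (Euc d) ℂ) (fun j => LinearMap.ext fun u =>
    temperedMultiplierHom_derivMultiplier ℂ _ u), ← coe_aeval_derivMultiplier]
  rfl

end DifferentialOperators

section FourierL1

variable {V F : Type*} [NormedAddCommGroup V] [InnerProductSpace ℝ V] [FiniteDimensional ℝ V]
  [MeasurableSpace V] [BorelSpace V] [NormedAddCommGroup F] [NormedSpace ℂ F]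

/-- The Fourier transform `x ↦ 𝓕 x ξ` at a point `ξ`, as a continuous linear map on `L¹`. -/
def fourierAt (ξ : V) : Lp F 1 (volume : Measure V) →L[ℂ] F :=
  LinearMap.mkContinuous
    { toFun x := 𝓕 (x : V → F) ξ
      map_add' x y := by
        simp only [Real.fourier_eq]
        rw [← integral_add ((Real.fourierIntegral_convergent_iff ξ).2 (L1.integrable_coeFn x))
          ((Real.fourierIntegral_convergent_iff ξ).2 (L1.integrable_coeFn y))]
        refine integral_congr_ae ?_
        filter_upwards [Lp.coeFn_add x y] with v hv
        rw [hv, Pi.add_apply, smul_add]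
      map_smul' c x := by
        simp only [Real.fourier_eq, RingHom.id_apply]
        rw [← integral_smul]
        refine integral_congr_ae ?_
        filter_upwards [Lp.coeFn_smul c x] with v hv
        rw [hv, Pi.smul_apply, smul_comm] } 1 fun x => by
    rw [one_mul, L1.norm_eq_integral_norm]
    exact VectorFourier.norm_fourierIntegral_le_integral_norm _ _ _ _ _

theorem fourierAt_toLp (ξ : V) (f : 𝓢(V, F)) : fourierAt ξ (f.toLp 1 volume) = 𝓕 f ξ := by
  change 𝓕 (f.toLp 1 volume : V → F) ξ = _
  rw [SchwartzMap.fourier_coe]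
  simp only [Real.fourier_eq]
  refine integral_congr_ae ?_
  filter_upwards [f.coeFn_toLp 1 volume] with v hv
  rw [hv]

theorem continuous_fourierAt (x : Lp F 1 (volume : Measure V)) :
    Continuous fun ξ => fourierAt ξ x :=
  VectorFourier.fourierIntegral_continuous Real.continuous_fourierChar
    (L := innerₗ V) continuous_inner (L1.integrable_coeFn x)

variable [CompleteSpace F]

theorem fourier_toTemperedDistributionCLM_apply (x : Lp F 1 (volume : Measure V)) (u : 𝓢(V, ℂ)) :
    𝓕 (Lp.toTemperedDistributionCLM F volume 1 x) u = ∫ ξ, u ξ • fourierAt ξ x := by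
  rw [TemperedDistribution.fourier_apply, Lp.toTemperedDistributionCLM_apply,
    Lp.toTemperedDistribution_apply]
  have h := VectorFourier.integral_fourierIntegral_smul_eq_flip (L := innerₗ V)
    (μ := volume) (ν := volume) Real.continuous_fourierChar continuous_inner
    (u.integrable (μ := volume)) (L1.integrable_coeFn x)
  simpa using! h

theorem eq_of_forall_integral_schwartzMap_smul_eq {g₁ g₂ : V → F} (h₁ : Continuous g₁)
    (h₂ : Continuous g₂) (h : ∀ u : 𝓢(V, ℂ), ∫ ξ, u ξ • g₁ ξ = ∫ ξ, u ξ • g₂ ξ) : g₁ = g₂ := by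
  refine (Continuous.ae_eq_iff_eq volume h₁ h₂).1 <| ae_eq_of_integral_contDiff_smul_eq
    h₁.locallyIntegrable h₂.locallyIntegrable fun g hg hc => ?_
  have hc' : HasCompactSupport (Complex.ofRealCLM ∘ g) := hc.comp_left rfl
  simpa using h (hc'.toSchwartzMap (Complex.ofRealCLM.contDiff.comp hg))

theorem fourierMultiplierCLM_toTemperedDistributionCLM_eq_iff {m : V → ℂ}
    (hm : m.HasTemperateGrowth) {x y : Lp F 1 (volume : Measure V)} :
    TemperedDistribution.fourierMultiplierCLM F m (Lp.toTemperedDistributionCLM F volume 1 x) =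
      Lp.toTemperedDistributionCLM F volume 1 y ↔ ∀ ξ, fourierAt ξ y = m ξ • fourierAt ξ x := by
  have hpairing (u : 𝓢(V, ℂ)) :
      TemperedDistribution.smulLeftCLM F m (𝓕 (Lp.toTemperedDistributionCLM F volume 1 x)) u =
        ∫ ξ, u ξ • m ξ • fourierAt ξ x := by
    rw [TemperedDistribution.smulLeftCLM_apply_apply, fourier_toTemperedDistributionCLM_apply]
    simp only [SchwartzMap.smulLeftCLM_apply_apply hm, smul_eq_mul, mul_smul, smul_comm (m _)]
  rw [TemperedDistribution.fourierMultiplierCLM_apply,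
    ← (FourierTransform.fourierEquiv ℂ 𝓢'(V, F)).injective.eq_iff]
  simp only [FourierTransform.fourierEquiv_apply, FourierTransform.fourier_fourierInv_eq,
    DFunLike.ext_iff, hpairing, fourier_toTemperedDistributionCLM_apply]
  refine ⟨fun h ξ => ?_, fun h u => by simp only [h]⟩
  exact congrFun (eq_of_forall_integral_schwartzMap_smul_eq (hm.1.continuous.smul
    (continuous_fourierAt x)) (continuous_fourierAt y) h).symm ξ

end FourierL1

section FourierDiagonalization

variable {V F : Type*} [NormedAddCommGroup V] [InnerProductSpace ℝ V] [FiniteDimensional ℝ V]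
  [MeasurableSpace V] [BorelSpace V] [NormedAddCommGroup F] [NormedSpace ℂ F]
  {m h : V → ℂ}

theorem exists_norm_toLp_fourierMultiplierCLM_pow_le (hh : h.HasTemperateGrowth) {A : ℝ}
    (hA : 0 < A) (p : ℝ≥0∞) [Fact (1 ≤ p)] {f : 𝓢(V, F)}
    (hf : ∀ ξ ∈ tsupport (𝓕 f : 𝓢(V, F)), ‖h ξ‖ ≤ A) :
    ∃ (C : ℝ) (k : ℕ), 0 < C ∧ ∀ n : ℕ,
      ‖(SchwartzMap.fourierMultiplierCLM F (h ^ n) f).toLp p volume‖ ≤ C * (n + 1) ^ k * A ^ n :=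
  exists_norm_map_smulLeftCLM_pow_le
    (SchwartzMap.toLpCLM ℂ F p volume ∘L FourierTransform.fourierInvCLM ℂ 𝓢(V, F)) hh hA (𝓕 f) hf

theorem limsup_enorm_toLp_fourierMultiplierCLM_pow_le (hh : h.HasTemperateGrowth) (p : ℝ≥0∞)
    [Fact (1 ≤ p)] (f : 𝓢(V, F)) :
    limsup (fun n : ℕ =>
      ‖(SchwartzMap.fourierMultiplierCLM F (h ^ n) f).toLp p volume‖ₑ ^ (1 / (n : ℝ))) atTop ≤
        ⨆ ξ ∈ tsupport (𝓕 f : 𝓢(V, F)), ‖h ξ‖ₑ := by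
  refine le_of_forall_gt_imp_ge_of_dense fun A hA => ?_
  induction A with
  | top => exact le_top
  | coe A =>
    have hf (ξ : V) (hξ : ξ ∈ tsupport (𝓕 f : 𝓢(V, F))) : ‖h ξ‖ ≤ A := by
      exact_mod_cast (le_iSup₂ (f := fun ξ _ => ‖h ξ‖ₑ) ξ hξ).trans hA.le
    have hA0 : 0 < (A : ℝ) := by exact_mod_cast pos_of_gt hA
    obtain ⟨C, k, hC, hbound⟩ := exists_norm_toLp_fourierMultiplierCLM_pow_le hh hA0 p hf
    refine limsup_rpow_one_div_le_of_le_mul_pow (tendsto_const_mul_succ_pow_rpow_one_div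
      (C := ENNReal.ofReal C) (by simpa using hC) ENNReal.ofReal_ne_top k) fun n => ?_
    calc _ ≤ ENNReal.ofReal (C * (n + 1) ^ k * A ^ n) := by
          rw [← ofReal_norm]
          exact ENNReal.ofReal_le_ofReal (hbound n)
      _ = _ := by
          rw [ENNReal.ofReal_mul (by positivity), ENNReal.ofReal_mul hC.le,
            ENNReal.ofReal_pow (by positivity), ENNReal.ofReal_pow A.coe_nonneg,
            ENNReal.ofReal_add (by positivity) zero_le_one, ENNReal.ofReal_natCast,
            ENNReal.ofReal_one, ENNReal.ofReal_coe_nnreal]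

variable [CompleteSpace F]
  {T : Lp F 1 (volume : Measure V) →ₗ.[ℂ] Lp F 1 (volume : Measure V)}

theorem fourier_fourierMultiplierCLM_apply (hm : m.HasTemperateGrowth) (f : 𝓢(V, F)) (ξ : V) :
    𝓕 (SchwartzMap.fourierMultiplierCLM F m f) ξ = m ξ • 𝓕 f ξ := by
  rw [SchwartzMap.fourierMultiplierCLM_apply, FourierTransform.fourier_fourierInv_eq,
    SchwartzMap.smulLeftCLM_apply_apply hm]

theorem toLp_fourierMultiplierCLM_mem_graph (hT : IsDiagonalizedBy T fourierAt m)
    (hm : m.HasTemperateGrowth) (f : 𝓢(V, F)) :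
    (f.toLp 1 volume, (SchwartzMap.fourierMultiplierCLM F m f).toLp 1 volume) ∈ T.graph := by
  rw [hT]
  intro ξ
  rw [fourierAt_toLp, fourierAt_toLp, fourier_fourierMultiplierCLM_apply hm]

theorem unbPow_toLp (hT : IsDiagonalizedBy T fourierAt m) (hm : m.HasTemperateGrowth)
    {f : 𝓢(V, F)} {n : ℕ} (hf : f.toLp 1 volume ∈ (unbPow T n).domain) :
    unbPow T n ⟨f.toLp 1 volume, hf⟩ =
      (SchwartzMap.fourierMultiplierCLM F (m ^ n) f).toLp 1 volume := by
  let M : temperateGrowthSubalgebra V := ⟨m, hm⟩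
  obtain ⟨_, hpow⟩ := exists_unbPow_eq_map_pow (D := schwartzMultiplierHom V F M)
    (L := fun f : 𝓢(V, F) => f.toLp 1 volume) (toLp_fourierMultiplierCLM_mem_graph hT hm) f n
  rw [hpow, ← map_pow]
  rfl

theorem tendsto_enorm_unbPow_toLp (hT : IsDiagonalizedBy T fourierAt m)
    (hm : m.HasTemperateGrowth) {f : 𝓢(V, F)}
    (hf : ∀ n, f.toLp 1 volume ∈ (unbPow T n).domain) :
    Tendsto (fun n => ‖unbPow T n ⟨f.toLp 1 volume, hf n⟩‖ₑ ^ (1 / (n : ℝ))) atTop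
      (𝓝 (⨆ z ∈ closure (m '' tsupport (𝓕 f : 𝓢(V, F))), ‖z‖ₑ)) := by
  refine tendsto_of_le_liminf_of_limsup_le ?_ ?_
  · rw [tsupport, closure_image_closure hm.1.continuous, iSup_enorm_closure, iSup_image]
    simpa only [fourierAt_toLp] using! hT.iSup_enorm_le_liminf hf
  · rw [iSup_enorm_closure, iSup_image]
    simpa only [unbPow_toLp hT hm] using limsup_enorm_toLp_fourierMultiplierCLM_pow_le hm 1 f

theorem mem_localResolventSet_toLp_of_sub_mul_eq_one (hT : IsDiagonalizedBy T fourierAt m)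
    (hh : h.HasTemperateGrowth) {A : ℝ} (hA : 0 < A) {f : 𝓢(V, F)} {z₀ : ℂ}
    (hmul : ∀ ξ ∈ tsupport (𝓕 f : 𝓢(V, F)), (m ξ - z₀) * h ξ = 1)
    (hle : ∀ ξ ∈ tsupport (𝓕 f : 𝓢(V, F)), ‖h ξ‖ ≤ A) :
    z₀ ∈ localResolventSet T (f.toLp 1 volume) := by
  let b (n : ℕ) : Lp F 1 (volume : Measure V) :=
    (SchwartzMap.fourierMultiplierCLM F (h ^ n) f).toLp 1 volume
  have hb₀ : b 0 = f.toLp 1 volume :=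
    congrArg (fun f : 𝓢(V, F) => f.toLp 1 volume) <| DFunLike.congr_fun
      ((SchwartzMap.fourierMultiplierCLM_const 1).trans (one_smul ℂ _)) f
  have hb (n : ℕ) : (b (n + 1), b n + z₀ • b (n + 1)) ∈ T.graph := by
    refine (hT _ _).2 fun ξ => ?_
    simp only [b, map_add, map_smul, fourierAt_toLp,
      fourier_fourierMultiplierCLM_apply (hh.pow _), Pi.pow_apply, smul_smul, ← add_smul]
    rcases eq_or_ne (𝓕 f ξ) 0 with h0 | h0
    · rw [h0, smul_zero, smul_zero]
    · congr 1
      linear_combination -h ξ ^ n * hmul ξ (subset_tsupport _ h0)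
  obtain ⟨C, k, hC, hbound⟩ := exists_norm_toLp_fourierMultiplierCLM_pow_le hh hA 1 hle
  have hsum : Summable fun n => ‖b (n + 1)‖ * (2 * A)⁻¹ ^ n := by
    have hgeom : Summable fun n : ℕ => ((n + 2 : ℕ) : ℝ) ^ k * (1 / 2) ^ (n + 2) :=
      (summable_nat_add_iff 2).2
        (summable_pow_mul_geometric_of_norm_lt_one k (r := (1 / 2 : ℝ)) (by norm_num))
    refine (hgeom.mul_left (4 * C * A)).of_nonneg_of_le (fun n => by positivity) fun n => ?_
    calc ‖b (n + 1)‖ * (2 * A)⁻¹ ^ n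
        ≤ C * ((n + 1 : ℕ) + 1) ^ k * A ^ (n + 1) * (2 * A)⁻¹ ^ n := by
          gcongr
          exact hbound (n + 1)
      _ = 4 * C * A * (((n + 2 : ℕ) : ℝ) ^ k * (1 / 2) ^ (n + 2)) := by
          rw [mul_inv, mul_pow, inv_pow A]
          push_cast
          field_simp
          ring
  exact hb₀ ▸ mem_localResolventSet_of_backwardOrbit hT.isClosed (by positivity) hb hsum

theorem mem_localResolventSet_toLp (hT : IsDiagonalizedBy T fourierAt m)
    (hm : m.HasTemperateGrowth) {f : 𝓢(V, F)} {z₀ : ℂ}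
    (hz₀ : z₀ ∉ closure (m '' tsupport (𝓕 f : 𝓢(V, F)))) :
    z₀ ∈ localResolventSet T (f.toLp 1 volume) := by
  obtain ⟨δ, hδ, hball⟩ := Metric.isOpen_iff.1 isClosed_closure.isOpen_compl z₀ hz₀
  have hsep (ξ : V) (hξ : ξ ∈ tsupport (𝓕 f : 𝓢(V, F))) : δ ≤ ‖m ξ - z₀‖ := by
    by_contra! hlt
    exact hball (mem_ball_iff_norm.2 hlt) (subset_closure ⟨ξ, hξ, rfl⟩)
  obtain ⟨ψ, hψ, hinv⟩ := exists_hasTemperateGrowth_eq_inv hδ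
  refine mem_localResolventSet_toLp_of_sub_mul_eq_one (h := fun ξ => ψ (m ξ - z₀)) hT
    (hψ.comp (hm.sub (.const z₀))) (inv_pos.2 hδ) (fun ξ hξ => ?_) fun ξ hξ => ?_
  · have hne : m ξ - z₀ ≠ 0 := norm_pos_iff.1 (hδ.trans_le (hsep ξ hξ))
    rw [hinv _ (hsep ξ hξ), mul_inv_cancel₀ hne]
  · rw [hinv _ (hsep ξ hξ), norm_inv]
    exact inv_anti₀ hδ (hsep ξ hξ)

theorem localSpectrum_toLp (hT : IsDiagonalizedBy T fourierAt m) (hm : m.HasTemperateGrowth)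
    (f : 𝓢(V, F)) :
    localSpectrum T (f.toLp 1 volume) = closure (m '' tsupport (𝓕 f : 𝓢(V, F))) := by
  refine Set.Subset.antisymm ?_ ?_
  · exact Set.compl_subset_comm.1 fun z₀ hz₀ => mem_localResolventSet_toLp hT hm hz₀
  · rw [tsupport, closure_image_closure hm.1.continuous]
    simpa only [fourierAt_toLp] using! hT.closure_image_subset_localSpectrum (f.toLp 1 volume)

end FourierDiagonalization

section ConstantCoefficients

variable {d : ℕ}

theorem isDiagonalizedBy_closedExt (P : MvPolynomial (Fin d) ℂ) :
    IsDiagonalizedBy (closedExt P) fourierAt (multiplier P) := fun x y => by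
  rw [closedExt_graph, ← fourierMultiplierCLM_toTemperedDistributionCLM_eq_iff
    (hasTemperateGrowth_multiplier P), ← diffOp_eq_temperedFourierMultiplierCLM]
  rfl

theorem toLp_diffOp_mem_graph_closedExt (P : MvPolynomial (Fin d) ℂ) (f : 𝓢(Euc d, ℂ)) :
    (f.toLp 1 volume, (diffOp P f).toLp 1 volume) ∈ (closedExt P).graph := by
  rw [diffOp_eq_fourierMultiplierCLM]
  exact toLp_fourierMultiplierCLM_mem_graph (isDiagonalizedBy_closedExt P)
    (hasTemperateGrowth_multiplier P) f

theorem fourierTr_eq (f : 𝓢(Euc d, ℂ)) (ξ : Euc d) :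
    fourierTr f ξ = (((2 * Real.pi) ^ (-(d : ℝ) / 2) : ℝ) : ℂ) * 𝓕 f ((2 * Real.pi)⁻¹ • ξ) := by
  have hinner (x : Euc d) : inner ℝ x ((2 * Real.pi)⁻¹ • ξ) =
      (2 * Real.pi)⁻¹ * ∑ j, ξ j * x j := by
    simp [inner_smul_right, PiLp.inner_apply]
  rw [fourierTr, SchwartzMap.fourier_coe, Real.fourier_eq']
  congr 1
  refine integral_congr_ae (.of_forall fun x => ?_)
  simp only [hinner, smul_eq_mul]
  rw [mul_comm]
  congr 2
  push_cast
  field_simp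

theorem tsupport_fourierTr (f : 𝓢(Euc d, ℂ)) :
    tsupport (fourierTr f) = ((2 * Real.pi) • ·) '' tsupport (𝓕 f : 𝓢(Euc d, ℂ)) := by
  have hpi : 2 * Real.pi ≠ 0 := by positivity
  let dilation : Euc d ≃ₜ Euc d := Homeomorph.smulOfNeZero (2 * Real.pi) hpi
  have hsupp : Function.support (fourierTr f) =
      dilation '' Function.support (𝓕 f : 𝓢(Euc d, ℂ)) := by
    have hc : (((2 * Real.pi) ^ (-(d : ℝ) / 2) : ℝ) : ℂ) ≠ 0 := by
      exact_mod_cast (Real.rpow_pos_of_pos (by positivity) _).ne'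
    rw [dilation.image_eq_preimage_symm]
    ext ξ
    rw [Function.mem_support, fourierTr_eq, mul_ne_zero_iff, and_iff_right hc]
    rfl
  rw [tsupport, hsupp, ← dilation.image_closure]
  rfl

theorem localSpectrum_closedExt_toLp (P : MvPolynomial (Fin d) ℂ) (f : 𝓢(Euc d, ℂ)) :
    localSpectrum (closedExt P) (f.toLp 1 volume) =
      closure (symbol P '' tsupport (fourierTr f)) := by
  rw [localSpectrum_toLp (isDiagonalizedBy_closedExt P) (hasTemperateGrowth_multiplier P),
    tsupport_fourierTr, Set.image_image]
  rfl

end ConstantCoefficients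

theorem mainTheorem12 (d : ℕ) (P : MvPolynomial (Fin d) ℂ) :
    (closedExt P).IsClosed ∧
    HasSVEP (closedExt P) ∧
    ∀ f : 𝓢(Euc d, ℂ),
      (∃ h : f.toLp 1 volume ∈ (closedExt P).domain,
        closedExt P ⟨f.toLp 1 volume, h⟩ = (diffOp P f).toLp 1 volume) ∧
      localSpectrum (closedExt P) (f.toLp 1 volume) =
        closure (symbol P '' tsupport (fourierTr f)) ∧
      ∃ h : ∀ n : ℕ, f.toLp 1 volume ∈ (unbPow (closedExt P) n).domain,
        (∀ n : ℕ, unbPow (closedExt P) n ⟨f.toLp 1 volume, h n⟩ =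
          ((diffOp P ^ n) f).toLp 1 volume) ∧
        Tendsto (fun n : ℕ =>
            ‖unbPow (closedExt P) n ⟨f.toLp 1 volume, h n⟩‖ₑ ^ (1 / (n : ℝ))) atTop
          (𝓝 (⨆ ξ ∈ tsupport (fourierTr f), ‖symbol P ξ‖ₑ)) ∧
        Tendsto (fun n : ℕ =>
            ‖unbPow (closedExt P) n ⟨f.toLp 1 volume, h n⟩‖ₑ ^ (1 / (n : ℝ))) atTop
          (𝓝 (⨆ z ∈ localSpectrum (closedExt P) (f.toLp 1 volume), ‖z‖ₑ)) := by
  have hT := isDiagonalizedBy_closedExt P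
  refine ⟨hT.isClosed, hT.hasSVEP, fun f => ?_⟩
  have hσ := localSpectrum_closedExt_toLp P f
  have hgraph := toLp_diffOp_mem_graph_closedExt P
  choose hdom hpow using fun n => exists_unbPow_eq_map_pow
    (L := fun f : 𝓢(Euc d, ℂ) => f.toLp 1 volume) hgraph f n
  have hlim := tendsto_enorm_unbPow_toLp hT (hasTemperateGrowth_multiplier P) hdom
  rw [← localSpectrum_toLp hT (hasTemperateGrowth_multiplier P)] at hlim
  refine ⟨exists_apply_eq_iff_mem_graph.2 (hgraph f), hσ, hdom, hpow, ?_, hlim⟩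
  rwa [hσ, iSup_enorm_closure, iSup_image] at hlim

end
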